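/- Let $A$ be a commutative Noetherian ring and $\Gamma$ a finitely generated commutative monoid, and let $R=A[\Gamma]$ be the monoid ring. For an ideal $\mathfrak a\subseteq R$, let $\operatorname{grade}(\mathfrak a)$ be the maximal length of an $R$-regular sequence contained in $\mathfrak a$; a proper ideal $\mathfrak a$ is called perfect if $\operatorname{grade}(\mathfrak a)$ equals the projective dimension of the $R$-module $R/\mathfrak a$. Let $\operatorname{cd}(R,\mathfrak a)$ be the cohomological dimension of $\mathfrak a$, i.e. the least natural number $c$ such that the local cohomology modules $H^i_{\mathfrak a}(M)$ vanish for all $R$-modules $M$ and all $i>c$, and let $\operatorname{ht}(\mathfrak a)$ be the height of $\mathfrak a$. If $\mathfrak a\subsetneq R$ is a perfect ideal generated by (the images in $R$ of the elements of) a subset of $\Gamma$, then $$\operatorname{cd}(R,\mathfrak a)=\operatorname{ht}(\mathfrak a).$$ -/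

import Mathlib

universe u

/-- The grade of `I`: the maximal length of an `R`-regular sequence of elements of `I`. -/
noncomputable def Ideal.grade {R : Type u} [CommRing R] (I : Ideal R) : ℕ∞ :=
  ⨆ (rs : List R) (_ : RingTheory.Sequence.IsRegular R rs) (_ : ∀ r ∈ rs, r ∈ I),
    (rs.length : ℕ∞)

/-- An ideal `I` is perfect if the projective dimension of `R ⧸ I` is equal to the grade of `I`.
The projective dimension of the zero module is `⊥`, so a perfect ideal is a proper ideal. -/
def Ideal.IsPerfect {R : Type u} [CommRing R] (I : Ideal R) : Prop :=
  CategoryTheory.projectiveDimension (ModuleCat.of R (R ⧸ I)) = (I.grade : WithBot ℕ∞)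

/-- The cohomological dimension of `I`: the least `c` such that the local cohomology modules
`H_I^i(M)` vanish for all `R`-modules `M` and all `i > c` (and `⊤` if there is no such natural
number). -/
noncomputable def Ideal.cohomologicalDimension {R : Type u} [CommRing R] (I : Ideal R) : ℕ∞ :=
  sInf {c : ℕ∞ | ∀ (M : ModuleCat.{u} R) (i : ℕ), c < (i : ℕ∞) →
    CategoryTheory.Limits.IsZero ((localCohomology I i).obj M)}

/-!
Raising monomials to the `t`-th power defines endomorphisms `φ t` of `R = A[Γ]`, and for `I`
generated by `ν` monomials `I ^ (ν * t + 1) ≤ (φ t I) R ≤ I ^ t`. Let `g` be the grade of `I`. By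
perfection `R ⧸ I` has a projective resolution of length `g`; as `φ t I` still contains a regular
sequence of length `g`, the resolution stays exact after base change along `φ t`, so the quotients
by the ideals `(φ t I) R`, which are cofinal with the powers of `I`, have projective dimension at
most `g`, and `cd I ≤ g`. Conversely `Ext^g(R ⧸ I, R) ≠ 0` embeds into `H_I^g(R)`, so `g ≤ cd I`.

To see that `ht I ≤ g`, localize at a minimal prime `P` of `I`, and let `L = R_P`. By dimension
shifting along the resolution, `L ⧸ φ t I` embeds into a power `(L ⧸ y) ^ b` with `b` independent of
`t`, where `y` is the sequence of `(ν * t + 1)`-th powers of a regular sequence of length `g` in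
`I`. So its length is `O(t ^ g)`. But it surjects onto `L ⧸ P ^ t`, whose length grows at least like
`t ^ ht P`.
-/

/-! ### Torsion in tensor products with a module of finite projective dimension -/

section StableAnnihilation

open TensorProduct RingTheory.Sequence CategoryTheory Pointwise

/-- `a` annihilates `K` in the stable module category: for `x ∈ a`, multiplication by `x` on `K`
factors through every surjection onto `K`. This notion, unlike `a • K = 0`, passes from a module to
its syzygies. -/
def StablyAnnihilates {R : Type u} [CommRing R] (a : Ideal R) (K : Type u) [AddCommGroup K]
    [Module R K] : Prop :=
  ∀ x ∈ a, ∀ (F : Type u) [AddCommGroup F] [Module R F] (p : F →ₗ[R] K), Function.Surjective p →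
    ∃ s : K →ₗ[R] F, p ∘ₗ s = x • LinearMap.id

/-- For every `R`-algebra `S`, every `S`-module `N` and every `N`-weakly regular sequence `xs` of
length `n` in `aS`, the submodule of elements of `N ⊗ K` killed by `xs` embeds into
`(N / xs N) ^ b`. For `N = S` it computes `Tor_n(S / xs, S ⊗ K)`. -/
def TorsionEmbeds {R : Type u} [CommRing R] (a : Ideal R) (K : Type u) [AddCommGroup K]
    [Module R K] (n b : ℕ) : Prop :=
  ∀ (S : Type u) [CommRing S] [Algebra R S] (N : Type u) [AddCommGroup N] [Module R N]
    [Module S N] [IsScalarTower R S N] (xs : List S), xs.length = n →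
    (∀ x ∈ xs, x ∈ a.map (algebraMap R S)) → IsWeaklyRegular N xs →
    ∃ f : Submodule.torsionBySet S (N ⊗[R] K) {x | x ∈ xs} →ₗ[S]
      (Fin b → N ⧸ (Ideal.ofList xs • ⊤ : Submodule S N)), Function.Injective f

variable {R : Type u} [CommRing R] {a : Ideal R} {K F : Type u}
  [AddCommGroup K] [Module R K] [AddCommGroup F] [Module R F]

lemma stablyAnnihilates_quotient (a : Ideal R) : StablyAnnihilates a (R ⧸ a) := by
  intro x hx F _ _ p _
  refine ⟨0, LinearMap.ext fun k ↦ ?_⟩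
  have hxk : x • k = 0 :=
    Module.mem_annihilator.1 ((Ideal.annihilator_quotient (I := a)).symm ▸ hx) k
  simp [hxk]

lemma StablyAnnihilates.exists_retraction (hK : StablyAnnihilates a K) {p : F →ₗ[R] K}
    (hp : Function.Surjective p) {x : R} (hx : x ∈ a) :
    ∃ h : F →ₗ[R] LinearMap.ker p, h ∘ₗ (LinearMap.ker p).subtype = x • LinearMap.id := by
  obtain ⟨s, hs⟩ := hK x hx F p hp
  have hs' (c : F) : p (s (p c)) = x • p c := LinearMap.congr_fun hs (p c)
  refine ⟨(x • LinearMap.id - s ∘ₗ p).codRestrict _ fun c ↦ by simp [hs'], ?_⟩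
  ext k
  simp

lemma StablyAnnihilates.ker [Module.Projective R F] (hK : StablyAnnihilates a K) {p : F →ₗ[R] K}
    (hp : Function.Surjective p) : StablyAnnihilates a (LinearMap.ker p) := by
  intro x hx G _ _ q hq
  obtain ⟨h, hh⟩ := hK.exists_retraction hp hx
  obtain ⟨l, hl⟩ := Module.projective_lifting_property q h hq
  exact ⟨l ∘ₗ (LinearMap.ker p).subtype, by rw [← LinearMap.comp_assoc, hl, hh]⟩

section Torsion

variable {S : Type*} [CommRing S] {M M' M'' Q : Type*} [AddCommGroup M] [Module S M]
  [AddCommGroup M'] [Module S M'] [AddCommGroup M''] [Module S M''] [AddCommGroup Q] [Module S Q]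

lemma smul_eq_zero_of_mem_map {A : Type*} [CommSemiring A] [Algebra A S] {I : Ideal A} {m : M}
    (h : ∀ x ∈ I, algebraMap A S x • m = 0) {y : S} (hy : y ∈ I.map (algebraMap A S)) :
    y • m = 0 := by
  have hle : I.map (algebraMap A S) ≤ LinearMap.ker (LinearMap.toSpanSingleton S M m) :=
    Ideal.map_le_iff_le_comap.2 fun x hx ↦ by simpa using h x hx
  simpa using hle hy

lemma torsionBySet_le_comap (f : M →ₗ[S] Q) (s : Set S) :
    Submodule.torsionBySet S M s ≤ (Submodule.torsionBySet S Q s).comap f := fun m hm ↦ by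
  rw [Submodule.mem_comap, Submodule.mem_torsionBySet_iff]
  intro x
  rw [← map_smul, (Submodule.mem_torsionBySet_iff _ _).1 hm, map_zero]

lemma exists_injective_torsionBy {i : M' →ₗ[S] M} {p : M →ₗ[S] M''}
    (hi : Function.Injective i) (hip : Function.Exact i p) (hp : Function.Surjective p)
    {x : S} (hx : IsSMulRegular M x) {π : M' →ₗ[S] Q}
    (hπ : Function.Exact (LinearMap.lsmul S M' x) π) :
    ∃ δ : Submodule.torsionBy S M'' x →ₗ[S] Q, Function.Injective δ := by
  have hker : Function.Exact (0 : M →ₗ[S] M) (LinearMap.lsmul S M x) :=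
    LinearMap.exact_zero_iff_injective M _ |>.2 hx
  have hker'' : Function.Exact (Submodule.torsionBy S M'' x).subtype (LinearMap.lsmul S M'' x) :=
    LinearMap.exact_subtype_ker_map _
  refine ⟨_, (LinearMap.exact_zero_iff_injective M _).1 <| SnakeLemma.exact_δ'_right
    (LinearMap.lsmul S M' x) (LinearMap.lsmul S M x) (LinearMap.lsmul S M'' x) i p hip i p hip
    (by ext; simp) (by ext; simp) 0 hker _ hker'' π hπ hp hi 0 (by simp)
    (Submodule.subtype_injective _)⟩

lemma exists_injective_torsionBySet_cons {i : M' →ₗ[S] M} {p : M →ₗ[S] M''}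
    (hi : Function.Injective i) (hip : Function.Exact i p) (hp : Function.Surjective p)
    {x : S} (hx : IsSMulRegular M x) {π : M' →ₗ[S] Q}
    (hπ : Function.Exact (LinearMap.lsmul S M' x) π) (rs : List S) :
    ∃ δ : Submodule.torsionBySet S M'' {y | y ∈ x :: rs} →ₗ[S]
      Submodule.torsionBySet S Q {y | y ∈ rs}, Function.Injective δ := by
  obtain ⟨δ, hδ⟩ := exists_injective_torsionBy hi hip hp hx hπ
  let T := Submodule.torsionBySet S M'' {y | y ∈ x :: rs}
  have hT : T ≤ Submodule.torsionBy S M'' x := fun u hu ↦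
    (Submodule.mem_torsionBySet_iff _ _).1 hu ⟨x, List.mem_cons_self⟩
  have hmem (u : T) : δ (Submodule.inclusion hT u) ∈ Submodule.torsionBySet S Q {y | y ∈ rs} := by
    refine torsionBySet_le_comap (δ ∘ₗ Submodule.inclusion hT) _ ?_
    rw [Submodule.mem_torsionBySet_iff]
    exact fun r ↦ Subtype.ext
      ((Submodule.mem_torsionBySet_iff _ _).1 u.2 ⟨r, List.mem_cons_of_mem x r.2⟩)
  exact ⟨(δ ∘ₗ Submodule.inclusion hT).codRestrict _ hmem, fun u v huv ↦
    Submodule.inclusion_injective hT (hδ (congrArg Subtype.val huv))⟩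

end Torsion

section TensorProduct

variable {S : Type u} [CommRing S] [Algebra R S] {N : Type u} [AddCommGroup N] [Module R N]
  [Module S N] [IsScalarTower R S N]

lemma isSMulRegular_tensor_fin_fun {x : S} (hx : IsSMulRegular N x) (m : ℕ) :
    IsSMulRegular (N ⊗[R] (Fin m → R)) x :=
  (LinearEquiv.isSMulRegular_congr (TensorProduct.piScalarRight R S N (Fin m)) x).2
    fun _ _ huv ↦ funext fun i ↦ hx (congrFun huv i)

lemma exact_lsmul_rTensor_mkQ_smul_top (x : S) (K : Type u) [AddCommGroup K] [Module R K] :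
    Function.Exact (LinearMap.lsmul S (N ⊗[R] K) x)
      (AlgebraTensorModule.rTensor R K (Submodule.mkQ (x • ⊤ : Submodule S N))) := by
  have hex := rTensor_exact K (f := (LinearMap.lsmul S N x).restrictScalars R)
    (g := (Submodule.mkQ (x • ⊤ : Submodule S N)).restrictScalars R)
    (LinearMap.exact_lsmul_mkQ_smul_top N x) (Submodule.mkQ_surjective (x • ⊤ : Submodule S N))
  have hx : LinearMap.rTensor K ((LinearMap.lsmul S N x).restrictScalars R) =
      (LinearMap.lsmul S (N ⊗[R] K) x).restrictScalars R :=
    TensorProduct.ext' fun _ _ ↦ rfl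
  rwa [hx] at hex

lemma exact_lTensor_subtype_ker {p : F →ₗ[R] K} (hp : Function.Surjective p) :
    Function.Exact (AlgebraTensorModule.lTensor S N (LinearMap.ker p).subtype)
      (AlgebraTensorModule.lTensor S N p) :=
  lTensor_exact N (LinearMap.exact_subtype_ker_map p) hp

lemma StablyAnnihilates.smul_eq_zero_of_lTensor_eq_zero (hK : StablyAnnihilates a K)
    {p : F →ₗ[R] K} (hp : Function.Surjective p) {u : N ⊗[R] LinearMap.ker p}
    (hu : AlgebraTensorModule.lTensor S N (LinearMap.ker p).subtype u = 0)
    {y : S} (hy : y ∈ a.map (algebraMap R S)) : y • u = 0 := by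
  refine smul_eq_zero_of_mem_map (fun x hx ↦ ?_) hy
  obtain ⟨h, hh⟩ := hK.exists_retraction hp hx
  have hxu : AlgebraTensorModule.lTensor S N h
      (AlgebraTensorModule.lTensor S N (LinearMap.ker p).subtype u) = x • u := by
    rw [← LinearMap.comp_apply, ← AlgebraTensorModule.lTensor_comp, hh, map_smul]
    simp
  rw [algebraMap_smul, ← hxu, hu, map_zero]

/-- An element of the kernel is killed by `aS`; the embedding of `TorsionEmbeds` maps it to
elements of `N / xs N` killed by the last element of the sequence, which is regular there. -/
lemma TorsionEmbeds.lTensor_subtype_injective (hK : StablyAnnihilates a K) {p : F →ₗ[R] K}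
    (hp : Function.Surjective p) {n b : ℕ} (hT : TorsionEmbeds a (LinearMap.ker p) n b)
    {xs : List S} (hlen : n < xs.length) (hmem : ∀ x ∈ xs, x ∈ a.map (algebraMap R S))
    (hreg : IsWeaklyRegular N xs) :
    Function.Injective (AlgebraTensorModule.lTensor S N (LinearMap.ker p).subtype) := by
  rw [injective_iff_map_eq_zero]
  intro u hu
  have hkill {y : S} (hy : y ∈ xs) : y • u = 0 :=
    hK.smul_eq_zero_of_lTensor_eq_zero hp hu (hmem y hy)
  have htake {y : S} (hy : y ∈ xs.take n) : y ∈ xs := List.mem_of_mem_take hy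
  have hreg_n := hreg.regular_mod_prev n hlen
  have hreg_take : IsWeaklyRegular N (xs.take n) :=
    ((isWeaklyRegular_append_iff N _ (xs.drop n)).1 (by rwa [List.take_append_drop])).1
  obtain ⟨f, hf⟩ := hT S N (xs.take n) (by simp [hlen.le]) (fun x hx ↦ hmem x (htake hx))
    hreg_take
  let u' : Submodule.torsionBySet S (N ⊗[R] LinearMap.ker p) {x | x ∈ xs.take n} :=
    ⟨u, (Submodule.mem_torsionBySet_iff _ _).2 fun y ↦ hkill (htake y.2)⟩
  have hzu : xs[n] • u' = 0 := Subtype.ext (hkill (List.getElem_mem hlen))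
  have hfu : f u' = 0 := by
    refine funext fun i ↦ hreg_n ?_
    simpa [hzu] using congrFun (f.map_smul xs[n] u').symm i
  exact congrArg Subtype.val (hf (hfu.trans (map_zero f).symm))

end TensorProduct

lemma TorsionEmbeds.succ (hK : StablyAnnihilates a K) {m : ℕ} {p : (Fin m → R) →ₗ[R] K}
    (hp : Function.Surjective p) {n b : ℕ} (hT : TorsionEmbeds a (LinearMap.ker p) n b) :
    TorsionEmbeds a K (n + 1) b := by
  intro S _ _ N _ _ _ _ xs hlen hmem hreg
  have hinj := hT.lTensor_subtype_injective hK hp (by lia) hmem hreg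
  obtain ⟨x, rs, rfl⟩ := List.exists_cons_of_length_eq_add_one hlen
  rw [isWeaklyRegular_cons_iff] at hreg
  obtain ⟨δ, hδ⟩ := exists_injective_torsionBySet_cons hinj (exact_lTensor_subtype_ker hp)
    (LinearMap.lTensor_surjective N hp) (isSMulRegular_tensor_fin_fun hreg.1 m)
    (exact_lsmul_rTensor_mkQ_smul_top x _) rs
  obtain ⟨f, hf⟩ := hT S (QuotSMulTop x N) rs (by simpa using hlen)
    (fun r hr ↦ hmem r (List.mem_cons_of_mem x hr)) hreg.2
  let e := LinearEquiv.piCongrRight fun _ : Fin b ↦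
    (Submodule.quotOfListConsSMulTopEquivQuotSMulTopInner N x rs).symm
  exact ⟨e.toLinearMap ∘ₗ f ∘ₗ δ, e.injective.comp (hf.comp hδ)⟩

lemma exists_torsionEmbeds_zero [Module.Finite R K] [Module.Projective R K] :
    ∃ b, TorsionEmbeds a K 0 b := by
  obtain ⟨b, p, hp⟩ := Module.Finite.exists_fin' R K
  obtain ⟨s, hs⟩ := Module.projective_lifting_property p LinearMap.id hp
  refine ⟨b, fun S _ _ N _ _ _ _ xs hlen _ _ ↦ ?_⟩
  obtain rfl := List.length_eq_zero_iff.1 hlen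
  let e : (Fin b → N) ≃ₗ[S] (Fin b → N ⧸ (Ideal.ofList ([] : List S) • ⊤ : Submodule S N)) :=
    LinearEquiv.piCongrRight fun _ ↦ (Submodule.quotEquivOfEqBot _ (by simp)).symm
  let e' := TensorProduct.piScalarRight R S N (Fin b)
  have hinj : Function.Injective (AlgebraTensorModule.lTensor S N s) := by
    refine Function.LeftInverse.injective (g := AlgebraTensorModule.lTensor S N p) fun u ↦ ?_
    rw [← LinearMap.comp_apply, ← AlgebraTensorModule.lTensor_comp, hs]
    simp
  exact ⟨e.toLinearMap ∘ₗ e'.toLinearMap ∘ₗ AlgebraTensorModule.lTensor S N s ∘ₗ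
    Submodule.subtype _, e.injective.comp
      (e'.injective.comp (hinj.comp (Submodule.subtype_injective _)))⟩

lemma hasProjectiveDimensionLE_of_projective (K : Type u) [AddCommGroup K] [Module R K]
    [Module.Projective R K] (n : ℕ) : HasProjectiveDimensionLE (ModuleCat.of R K) n :=
  have : Projective (ModuleCat.of R K) := (IsProjective.iff_projective _).1 inferInstance
  hasProjectiveDimensionLT_of_ge (ModuleCat.of R K) 1 _ (by lia)

lemma projective_of_hasProjectiveDimensionLE_zero
    (hK : HasProjectiveDimensionLE (ModuleCat.of R K) 0) : Module.Projective R K :=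
  (IsProjective.iff_projective K).2 ((projective_iff_hasProjectiveDimensionLE_zero _).2 hK)

lemma hasProjectiveDimensionLE_ker [Module.Projective R F] {p : F →ₗ[R] K}
    (hp : Function.Surjective p) {n : ℕ}
    (hK : HasProjectiveDimensionLE (ModuleCat.of R K) (n + 1)) :
    HasProjectiveDimensionLE (ModuleCat.of R (LinearMap.ker p)) n :=
  (LinearMap.shortExact_shortComplexKer hp).hasProjectiveDimensionLT_X₁ (n + 1)
    (hasProjectiveDimensionLE_of_projective F n) hK

lemma hasProjectiveDimensionLE_of_exact {K' : Type u} [AddCommGroup K'] [Module R K']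
    [Module.Projective R F] {i : K' →ₗ[R] F} {p : F →ₗ[R] K} (hi : Function.Injective i)
    (hip : Function.Exact i p) (hp : Function.Surjective p) {n : ℕ}
    (hK' : HasProjectiveDimensionLE (ModuleCat.of R K') n) :
    HasProjectiveDimensionLE (ModuleCat.of R K) (n + 1) := by
  let C : ShortComplex (ModuleCat.{u} R) := ShortComplex.mk (ModuleCat.ofHom i)
    (ModuleCat.ofHom p) (by rw [← ModuleCat.ofHom_comp, hip.linearMap_comp_eq_zero]; rfl)
  have hC : C.ShortExact := ModuleCat.shortComplex_shortExact C hip hi hp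
  exact hC.hasProjectiveDimensionLT_X₃ (n + 1) hK' (hasProjectiveDimensionLE_of_projective F _)

theorem StablyAnnihilates.exists_torsionEmbeds [IsNoetherianRing R] [Module.Finite R K]
    (hK : StablyAnnihilates a K) {n : ℕ}
    (hpd : HasProjectiveDimensionLE (ModuleCat.of R K) n) : ∃ b, TorsionEmbeds a K n b := by
  induction n generalizing K with
  | zero =>
    have := projective_of_hasProjectiveDimensionLE_zero hpd
    exact exists_torsionEmbeds_zero
  | succ n ih =>
    obtain ⟨m, p, hp⟩ := Module.Finite.exists_fin' R K
    obtain ⟨b, hT⟩ := ih (hK.ker hp) (hasProjectiveDimensionLE_ker hp hpd)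
    exact ⟨b, hT.succ hK hp⟩

theorem StablyAnnihilates.hasProjectiveDimensionLE_baseChange [IsNoetherianRing R]
    [Module.Finite R K] (hK : StablyAnnihilates a K) {n : ℕ}
    (hpd : HasProjectiveDimensionLE (ModuleCat.of R K) n) {S : Type u} [CommRing S] [Algebra R S]
    {xs : List S} (hlen : n ≤ xs.length) (hmem : ∀ x ∈ xs, x ∈ a.map (algebraMap R S))
    (hreg : IsWeaklyRegular S xs) :
    HasProjectiveDimensionLE (ModuleCat.of S (S ⊗[R] K)) n := by
  induction n generalizing K with
  | zero =>
    have := projective_of_hasProjectiveDimensionLE_zero hpd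
    exact hasProjectiveDimensionLE_of_projective _ 0
  | succ n ih =>
    obtain ⟨m, p, hp⟩ := Module.Finite.exists_fin' R K
    have hker := hasProjectiveDimensionLE_ker hp hpd
    obtain ⟨b, hT⟩ := (hK.ker hp).exists_torsionEmbeds hker
    exact hasProjectiveDimensionLE_of_exact
      (hT.lTensor_subtype_injective hK hp hlen hmem hreg) (exact_lTensor_subtype_ker hp)
      (LinearMap.lTensor_surjective S hp) (ih (hK.ker hp) hker (by lia))

end StableAnnihilation

/-! ### Submodules of finite length in quotients by powers of regular sequences -/

section MaxFiniteLength

open RingTheory.Sequence Pointwise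

/-- The supremum of the lengths of the submodules of finite length of `M`. For a Noetherian module
over a local ring it is the length of the zeroth local cohomology of `M` at the maximal ideal. -/
noncomputable def maxFiniteLength (R M : Type*) [CommRing R] [AddCommGroup M] [Module R M] : ℕ∞ :=
  ⨆ (N : Submodule R M) (_ : Module.length R N ≠ ⊤), Module.length R N

variable {R : Type*} [CommRing R] {M M' M'' : Type*} [AddCommGroup M] [Module R M]
  [AddCommGroup M'] [Module R M'] [AddCommGroup M''] [Module R M'']

lemma length_le_maxFiniteLength {f : M' →ₗ[R] M} (hf : Function.Injective f)
    (h : Module.length R M' ≠ ⊤) : Module.length R M' ≤ maxFiniteLength R M := by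
  rw [(LinearEquiv.ofInjective f hf).length_eq] at h ⊢
  exact le_iSup₂_of_le _ h le_rfl

lemma maxFiniteLength_le_of_injective {f : M' →ₗ[R] M} (hf : Function.Injective f) :
    maxFiniteLength R M' ≤ maxFiniteLength R M :=
  iSup₂_le fun N hN ↦ length_le_maxFiniteLength (f := f ∘ₗ N.subtype)
    (hf.comp N.subtype_injective) hN

lemma maxFiniteLength_congr (e : M ≃ₗ[R] M') : maxFiniteLength R M = maxFiniteLength R M' :=
  le_antisymm (maxFiniteLength_le_of_injective (f := e.toLinearMap) e.injective)
    (maxFiniteLength_le_of_injective (f := e.symm.toLinearMap) e.symm.injective)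

lemma maxFiniteLength_of_subsingleton [Subsingleton M] : maxFiniteLength R M = 0 := by
  simp [maxFiniteLength]

lemma maxFiniteLength_le_add_of_exact {i : M' →ₗ[R] M} {p : M →ₗ[R] M''}
    (hi : Function.Injective i) (hip : Function.Exact i p) :
    maxFiniteLength R M ≤ maxFiniteLength R M' + maxFiniteLength R M'' := by
  refine iSup₂_le fun N hN ↦ ?_
  let f : N.comap i →ₗ[R] N := i.restrict fun x hx ↦ hx
  let g : N →ₗ[R] M'' := p ∘ₗ N.subtype
  have hf : Function.Injective f := fun x y hxy ↦ Subtype.ext (hi (congrArg Subtype.val hxy))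
  have hfg : Function.Exact f g.rangeRestrict := by
    rintro ⟨x, hx⟩
    rw [← Subtype.val_inj]
    refine (hip x).trans ⟨?_, ?_⟩
    · rintro ⟨y, rfl⟩
      exact ⟨⟨y, hx⟩, rfl⟩
    · rintro ⟨y, hy⟩
      exact ⟨y, congrArg Subtype.val hy⟩
  have hlen := Module.length_eq_add_of_exact f g.rangeRestrict hf g.surjective_rangeRestrict hfg
  rw [hlen, ne_eq, ENat.add_eq_top, not_or] at hN
  rw [hlen]
  exact add_le_add (le_iSup₂_of_le _ hN.1 le_rfl) (le_iSup₂_of_le _ hN.2 le_rfl)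

lemma maxFiniteLength_fin_fun_le (b : ℕ) :
    maxFiniteLength R (Fin b → M) ≤ b * maxFiniteLength R M := by
  refine iSup₂_le fun N hN ↦ ?_
  let g (i : Fin b) : N →ₗ[R] M := LinearMap.proj i ∘ₗ N.subtype
  have hg : Function.Injective (LinearMap.pi fun i ↦ (g i).rangeRestrict) := fun x y hxy ↦
    Subtype.ext (funext fun i ↦ congrArg Subtype.val (congrFun hxy i))
  have hrange (i : Fin b) : Module.length R (LinearMap.range (g i)) ≠ ⊤ :=
    ne_top_of_le_ne_top hN (Module.length_le_of_surjective _ (g i).surjective_rangeRestrict)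
  calc Module.length R N ≤ Module.length R (Π i, LinearMap.range (g i)) :=
        Module.length_le_of_injective _ hg
    _ = ∑ i, Module.length R (LinearMap.range (g i)) := Module.length_pi_of_fintype _ _
    _ ≤ ∑ _i : Fin b, maxFiniteLength R M :=
        Finset.sum_le_sum fun i _ ↦ le_iSup₂_of_le _ (hrange i) le_rfl
    _ = b * maxFiniteLength R M := by simp

lemma length_sup_ne_top {N N' : Submodule R M} (hN : Module.length R N ≠ ⊤)
    (hN' : Module.length R N' ≠ ⊤) : Module.length R ↥(N ⊔ N') ≠ ⊤ := by
  have hrange : LinearMap.range (N.subtype.coprod N'.subtype) = N ⊔ N' := by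
    rw [LinearMap.range_coprod, Submodule.range_subtype, Submodule.range_subtype]
  rw [← hrange]
  refine ne_top_of_le_ne_top ?_ (Module.length_le_of_surjective _
    (N.subtype.coprod N'.subtype).surjective_rangeRestrict)
  rw [Module.length_prod]
  exact WithTop.add_ne_top.2 ⟨hN, hN'⟩

lemma maxFiniteLength_ne_top [IsNoetherian R M] : maxFiniteLength R M ≠ ⊤ := by
  obtain ⟨N₀, h₀, hmax⟩ := set_has_maximal_iff_noetherian.2 ‹IsNoetherian R M›
    {N : Submodule R M | Module.length R N ≠ ⊤} ⟨⊥, by simp⟩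
  refine ne_top_of_le_ne_top h₀ (iSup₂_le fun N hN ↦ ?_)
  have hle : N ≤ N₀ := by
    by_contra hN_not_le
    exact hmax _ (length_sup_ne_top h₀ hN) (left_lt_sup.2 hN_not_le)
  exact Module.length_le_of_injective _ (Submodule.inclusion_injective hle)

end MaxFiniteLength

section RegularPowers

open RingTheory.Sequence Pointwise

variable {R : Type*} [CommRing R] {M M' M'' : Type*} [AddCommGroup M] [Module R M]
  [AddCommGroup M'] [Module R M'] [AddCommGroup M''] [Module R M'']

lemma quotSMulTop_map_injective {i : M' →ₗ[R] M} {p : M →ₗ[R] M''} (hi : Function.Injective i)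
    (hip : Function.Exact i p) {r : R} (hr : IsSMulRegular M'' r) :
    Function.Injective (QuotSMulTop.map r i) := by
  have hex := QuotSMulTop.map_first_exact_on_four_term_exact_of_isSMulRegular_last
    ((LinearMap.exact_zero_iff_injective PUnit i).2 hi) hip hr
  rwa [map_zero, LinearMap.exact_zero_iff_injective] at hex

lemma isWeaklyRegular_of_exact {rs : List R} {i : M' →ₗ[R] M} {p : M →ₗ[R] M''}
    (hi : Function.Injective i) (hip : Function.Exact i p) (hp : Function.Surjective p)
    (h' : IsWeaklyRegular M' rs) (h'' : IsWeaklyRegular M'' rs) : IsWeaklyRegular M rs := by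
  induction rs generalizing M' M M'' with
  | nil => exact .nil R M
  | cons r rs ih =>
    rw [isWeaklyRegular_cons_iff] at h' h'' ⊢
    exact ⟨isSMulRegular_of_range_eq_ker hi hip.linearMap_ker_eq.symm h'.1 h''.1,
      ih (quotSMulTop_map_injective hi hip h''.1) (QuotSMulTop.map_exact r hip hp)
        (QuotSMulTop.map_surjective r hp) h'.2 h''.2⟩

lemma isWeaklyRegular_of_subsingleton [Subsingleton M] (rs : List R) : IsWeaklyRegular M rs :=
  ⟨fun _ _ _ _ _ ↦ Subsingleton.elim _ _⟩

lemma maxFiniteLength_quotient_le_add_of_exact {rs : List R} {i : M' →ₗ[R] M} {p : M →ₗ[R] M''}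
    (hi : Function.Injective i) (hip : Function.Exact i p) (hp : Function.Surjective p)
    (h'' : IsWeaklyRegular M'' rs) :
    maxFiniteLength R (M ⧸ (Ideal.ofList rs • ⊤ : Submodule R M)) ≤
      maxFiniteLength R (M' ⧸ (Ideal.ofList rs • ⊤ : Submodule R M')) +
        maxFiniteLength R (M'' ⧸ (Ideal.ofList rs • ⊤ : Submodule R M'')) := by
  have hi' := map_first_exact_on_four_term_right_exact_of_isSMulRegular_last
    ((LinearMap.exact_zero_iff_injective PUnit i).2 hi) hip hp h''
  have hip' := map_first_exact_on_four_term_right_exact_of_isSMulRegular_last hip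
    ((LinearMap.exact_zero_iff_surjective PUnit p).2 hp) (Function.surjective_to_subsingleton _)
    (isWeaklyRegular_of_subsingleton rs)
  rw [Submodule.mapQ_zero, LinearMap.exact_zero_iff_injective] at hi'
  exact maxFiniteLength_le_add_of_exact hi' hip'

lemma exists_exact_quotSMulTop_mul {r : R} (hr : IsSMulRegular M r) (t : R) :
    ∃ (i : QuotSMulTop t M →ₗ[R] QuotSMulTop (r * t) M)
      (p : QuotSMulTop (r * t) M →ₗ[R] QuotSMulTop r M),
      Function.Injective i ∧ Function.Exact i p ∧ Function.Surjective p := by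
  have hmap : (t • ⊤ : Submodule R M).map (LinearMap.lsmul R M r) = (r * t) • ⊤ :=
    (mul_smul r t ⊤).symm
  have hrange : LinearMap.range (LinearMap.lsmul R M r) = r • ⊤ := LinearMap.range_eq_map _
  have hle : (r * t) • (⊤ : Submodule R M) ≤ r • ⊤ := by
    rw [← hmap, ← hrange]
    exact LinearMap.map_le_range
  refine ⟨Submodule.mapQ _ _ (LinearMap.lsmul R M r) (Submodule.map_le_iff_le_comap.1 hmap.le),
    Submodule.factor hle, ?_, ?_, Submodule.factor_surjective hle⟩
  · rw [← LinearMap.ker_eq_bot, Submodule.ker_mapQ, ← hmap,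
      Submodule.comap_map_eq_of_injective (f := LinearMap.lsmul R M r) hr, Submodule.mkQ_map_self]
  · rw [LinearMap.exact_iff, Submodule.factor, Submodule.ker_mapQ, Submodule.comap_id,
      Submodule.range_mapQ, hrange]

lemma isWeaklyRegular_cons_mul {r t : R} {rs : List R} (hr : IsWeaklyRegular M (r :: rs))
    (ht : IsWeaklyRegular M (t :: rs)) : IsWeaklyRegular M (r * t :: rs) := by
  rw [isWeaklyRegular_cons_iff] at hr ht ⊢
  obtain ⟨i, p, hi, hip, hp⟩ := exists_exact_quotSMulTop_mul hr.1 t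
  exact ⟨hr.1.mul ht.1, isWeaklyRegular_of_exact hi hip hp ht.2 hr.2⟩

lemma maxFiniteLength_cons_mul_le {r : R} {rs : List R} (hr : IsWeaklyRegular M (r :: rs))
    (t : R) :
    maxFiniteLength R (M ⧸ (Ideal.ofList (r * t :: rs) • ⊤ : Submodule R M)) ≤
      maxFiniteLength R (M ⧸ (Ideal.ofList (t :: rs) • ⊤ : Submodule R M)) +
        maxFiniteLength R (M ⧸ (Ideal.ofList (r :: rs) • ⊤ : Submodule R M)) := by
  rw [isWeaklyRegular_cons_iff] at hr
  obtain ⟨i, p, hi, hip, hp⟩ := exists_exact_quotSMulTop_mul hr.1 t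
  simp only [maxFiniteLength_congr (Submodule.quotOfListConsSMulTopEquivQuotSMulTopInner M _ rs)]
  exact maxFiniteLength_quotient_le_add_of_exact hi hip hp hr.2

lemma isWeaklyRegular_cons_pow {r : R} {rs : List R} (h : IsWeaklyRegular M (r :: rs)) (s : ℕ) :
    IsWeaklyRegular M (r ^ s :: rs) := by
  induction s with
  | zero =>
    have : Subsingleton (QuotSMulTop (r ^ 0) M) :=
      Submodule.Quotient.subsingleton_iff.2 (by rw [pow_zero, one_smul])
    rw [isWeaklyRegular_cons_iff]
    exact ⟨pow_zero r ▸ IsSMulRegular.one M, isWeaklyRegular_of_subsingleton rs⟩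
  | succ s ih => exact pow_succ' r s ▸ isWeaklyRegular_cons_mul h ih

lemma maxFiniteLength_cons_pow_le {r : R} {rs : List R} (h : IsWeaklyRegular M (r :: rs)) (s : ℕ) :
    maxFiniteLength R (M ⧸ (Ideal.ofList (r ^ s :: rs) • ⊤ : Submodule R M)) ≤
      s * maxFiniteLength R (M ⧸ (Ideal.ofList (r :: rs) • ⊤ : Submodule R M)) := by
  induction s with
  | zero =>
    have : Subsingleton (M ⧸ (Ideal.ofList (r ^ 0 :: rs) • ⊤ : Submodule R M)) :=
      Submodule.Quotient.subsingleton_iff.2 (by simp)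
    simp [maxFiniteLength_of_subsingleton]
  | succ s ih =>
    rw [pow_succ', Nat.cast_succ, add_mul, one_mul]
    exact (maxFiniteLength_cons_mul_le h _).trans (add_le_add_left ih _)

theorem isWeaklyRegular_map_pow {rs : List R} (h : IsWeaklyRegular M rs) (s : ℕ) :
    IsWeaklyRegular M (rs.map (· ^ s)) := by
  induction rs generalizing M with
  | nil => exact .nil R M
  | cons r rs ih =>
    have hs := isWeaklyRegular_cons_pow h s
    rw [isWeaklyRegular_cons_iff] at hs
    exact (isWeaklyRegular_cons_iff M _ _).2 ⟨hs.1, ih hs.2⟩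

theorem maxFiniteLength_map_pow_le {rs : List R} (h : IsWeaklyRegular M rs) (s : ℕ) :
    maxFiniteLength R (M ⧸ (Ideal.ofList (rs.map (· ^ s)) • ⊤ : Submodule R M)) ≤
      s ^ rs.length * maxFiniteLength R (M ⧸ (Ideal.ofList rs • ⊤ : Submodule R M)) := by
  induction rs generalizing M with
  | nil => rw [List.map_nil, List.length_nil, pow_zero, one_mul]
  | cons r rs ih =>
    have hs := ((isWeaklyRegular_cons_iff M _ _).1 (isWeaklyRegular_cons_pow h s)).2
    calc maxFiniteLength R (M ⧸ (Ideal.ofList ((r :: rs).map (· ^ s)) • ⊤ : Submodule R M))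
        = maxFiniteLength R (QuotSMulTop (r ^ s) M ⧸
            (Ideal.ofList (rs.map (· ^ s)) • ⊤ : Submodule R (QuotSMulTop (r ^ s) M))) :=
          maxFiniteLength_congr (Submodule.quotOfListConsSMulTopEquivQuotSMulTopInner M _ _)
      _ ≤ s ^ rs.length * maxFiniteLength R (QuotSMulTop (r ^ s) M ⧸
            (Ideal.ofList rs • ⊤ : Submodule R (QuotSMulTop (r ^ s) M))) := ih hs
      _ = s ^ rs.length *
            maxFiniteLength R (M ⧸ (Ideal.ofList (r ^ s :: rs) • ⊤ : Submodule R M)) := by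
          rw [maxFiniteLength_congr (Submodule.quotOfListConsSMulTopEquivQuotSMulTopInner M _ rs)]
      _ ≤ s ^ rs.length *
            (s * maxFiniteLength R (M ⧸ (Ideal.ofList (r :: rs) • ⊤ : Submodule R M))) := by
          gcongr
          exact maxFiniteLength_cons_pow_le h s
      _ = _ := by rw [List.length_cons, pow_succ, mul_assoc]

end RegularPowers

/-! ### A lower bound for Hilbert–Samuel functions -/

section HilbertSamuel

variable {B : Type*} [CommRing B]

lemma length_quotient_add_length_quotient_le {I J J' : Ideal B} {x : B}
    (hJ : ∀ u, x * u ∈ I → u ∈ J) (hI : I ≤ J') (hx : x ∈ J') :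
    Module.length B (B ⧸ J) + Module.length B (B ⧸ J') ≤ Module.length B (B ⧸ I) := by
  let mulX : B →ₗ[B] B ⧸ I := I.mkQ ∘ₗ LinearMap.lsmul B B x
  have hker : LinearMap.ker mulX ≤ J := fun u hu ↦
    hJ u ((Submodule.Quotient.mk_eq_zero I).1 hu)
  have hrange : LinearMap.range mulX ≤ LinearMap.ker (Submodule.factor hI) := by
    rintro _ ⟨u, rfl⟩
    exact (Submodule.Quotient.mk_eq_zero J').2 (J'.mul_mem_right u hx)
  rw [Module.length_eq_add_of_exact (LinearMap.range mulX).subtype (LinearMap.range mulX).mkQ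
    (Submodule.subtype_injective _) (Submodule.mkQ_surjective _)
    (LinearMap.exact_subtype_mkQ _), ← mulX.quotKerEquivRange.length_eq]
  refine add_le_add (Module.length_le_of_surjective _ (Submodule.factor_surjective hker))
    (Module.length_le_of_surjective ((LinearMap.range mulX).liftQ _ hrange) fun y ↦ ?_)
  obtain ⟨z, rfl⟩ := Submodule.factor_surjective hI y
  exact ⟨Submodule.mkQ _ z, rfl⟩

lemma mkQ_mem_smul_top_iff {p I : Ideal B} {u : B} :
    p.mkQ u ∈ (I • ⊤ : Submodule B (B ⧸ p)) ↔ u ∈ p ⊔ I := by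
  have : (I • ⊤ : Submodule B (B ⧸ p)) = Submodule.map p.mkQ I := by
    rw [← Submodule.range_mkQ p, ← Submodule.map_top, ← Submodule.map_smul'', smul_eq_mul,
      Ideal.mul_top]
  rw [this, ← Submodule.mem_comap, Submodule.comap_map_mkQ]

lemma exists_mem_sup_pow_of_mul_mem_sup_pow [IsNoetherianRing B] (m : Ideal B) {p : Ideal B}
    [p.IsPrime] {x : B} (hx : x ∉ p) :
    ∃ k, ∀ n u, x * u ∈ p ⊔ m ^ n → u ∈ p ⊔ m ^ (n - k) := by
  let mulX : (B ⧸ p) →ₗ[B] (B ⧸ p) := LinearMap.lsmul B (B ⧸ p) x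
  have hinj : Function.Injective mulX := by
    rw [injective_iff_map_eq_zero]
    intro u hu
    obtain ⟨u, rfl⟩ := Ideal.Quotient.mk_surjective u
    have h : Ideal.Quotient.mk p (x * u) = 0 := hu
    rw [Ideal.Quotient.eq_zero_iff_mem] at h ⊢
    exact (Ideal.IsPrime.mem_or_mem ‹_› h).resolve_left hx
  obtain ⟨k, artinRees⟩ := Ideal.exists_pow_inf_eq_pow_smul m (LinearMap.range mulX)
  refine ⟨k, fun n u hu ↦ ?_⟩
  rcases lt_or_ge n k with h | h
  · simp [Nat.sub_eq_zero_of_le h.le]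
  rw [← mkQ_mem_smul_top_iff] at hu ⊢
  have hmem : mulX (p.mkQ u) ∈ m ^ (n - k) • LinearMap.range mulX :=
    (artinRees n h).le.trans (smul_mono_right _ inf_le_right) ⟨hu, _, rfl⟩
  rw [← Submodule.map_top, ← Submodule.map_smul''] at hmem
  obtain ⟨w, hw, hwu⟩ := hmem
  rwa [← hinj hwu]

lemma exists_choose_succ_le_length_quotient [IsNoetherianRing B] {m p p' : Ideal B} [p.IsPrime]
    (hlt : p < p') {h k' : ℕ}
    (hp' : ∀ n, (n.choose h : ℕ∞) ≤ Module.length B (B ⧸ p' ⊔ m ^ (k' * n + 1))) :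
    ∃ k, ∀ n, (n.choose (h + 1) : ℕ∞) ≤ Module.length B (B ⧸ p ⊔ m ^ (k * n + 1)) := by
  obtain ⟨x, hxp', hxp⟩ := SetLike.exists_of_lt hlt
  obtain ⟨k'', hk''⟩ := exists_mem_sup_pow_of_mul_mem_sup_pow m hxp
  refine ⟨max k' k'', fun n ↦ ?_⟩
  induction n with
  | zero => simp
  | succ n ih =>
    have hcolon (u : B) (hu : x * u ∈ p ⊔ m ^ (max k' k'' * (n + 1) + 1)) :
        u ∈ p ⊔ m ^ (max k' k'' * n + 1) := by
      have hexp : max k' k'' * n + 1 ≤ max k' k'' * (n + 1) + 1 - k'' := by grind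
      exact (sup_le_sup_left (Ideal.pow_le_pow_right hexp) p :) (hk'' _ u hu)
    have hle : p ⊔ m ^ (max k' k'' * (n + 1) + 1) ≤ p' ⊔ m ^ (k' * n + 1) := by
      refine sup_le_sup hlt.le (Ideal.pow_le_pow_right ?_)
      gcongr
      · exact le_max_left _ _
      · exact n.le_succ
    calc ((n + 1).choose (h + 1) : ℕ∞) = n.choose (h + 1) + n.choose h := by
          rw [Nat.choose_succ_succ, add_comm, Nat.cast_add]
      _ ≤ Module.length B (B ⧸ p ⊔ m ^ (max k' k'' * n + 1)) +
          Module.length B (B ⧸ p' ⊔ m ^ (k' * n + 1)) := add_le_add ih (hp' n)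
      _ ≤ _ := length_quotient_add_length_quotient_le hcolon hle (Ideal.mem_sup_left hxp')

theorem exists_choose_le_length_quotient [IsNoetherianRing B] {m : Ideal B}
    (q : LTSeries (PrimeSpectrum B)) (hq : q.last.asIdeal ⊔ m ≠ ⊤) :
    ∃ k, ∀ n, (n.choose q.length : ℕ∞) ≤
      Module.length B (B ⧸ q.head.asIdeal ⊔ m ^ (k * n + 1)) := by
  induction q using RelSeries.inductionOn with
  | singleton p =>
    refine ⟨0, fun n ↦ ?_⟩
    simpa [Order.one_le_iff_ne_zero, Module.length_eq_zero_iff,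
      Submodule.Quotient.subsingleton_iff] using hq
  | cons q p hlt ih =>
    obtain ⟨k, hk⟩ := ih (by simpa using hq)
    have hlt' : p.asIdeal < q.head.asIdeal := hlt
    rw [RelSeries.cons_length, RelSeries.head_cons]
    exact exists_choose_succ_le_length_quotient hlt' hk

end HilbertSamuel

/-! ### The functors `Ext R C n` and the groups `Abelian.Ext` -/

section ExtComparison

open CategoryTheory Limits Opposite

lemma epi_leftDerived_map_of_epi {C D : Type*} [Category* C] [Category* D] [Abelian C] [Abelian D]
    [HasProjectiveResolutions C] (F : C ⥤ D) [F.Additive] {X' X : C} {g : X' ⟶ X}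
    {P' : ProjectiveResolution X'} {P : ProjectiveResolution X}
    (φ : ProjectiveResolution.Hom P' P g) (n : ℕ)
    [Epi ((F.mapHomologicalComplex _ ⋙ HomologicalComplex.homologyFunctor _ _ n).map φ.hom)] :
    Epi ((F.leftDerived n).map g) := by
  have hnat := ProjectiveResolution.isoLeftDerivedObj_hom_naturality g P' P φ.hom
    (by simpa using φ.hom_f_zero_comp_π_f_zero) F n
  rw [← cancel_mono (P.isoLeftDerivedObj F n).inv] at hnat
  simp only [Category.assoc, Iso.hom_inv_id, Category.comp_id] at hnat
  rw [hnat]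
  infer_instance

variable {R : Type u} [CommRing R]

lemma isZero_Ext_succ_iff_subsingleton (X Y : ModuleCat.{u} R) (n : ℕ) :
    IsZero (((Ext R (ModuleCat.{u} R) (n + 1)).obj (op X)).obj Y) ↔
      Subsingleton (Abelian.Ext X Y (n + 1)) := by
  let P := projectiveResolution X
  rw [(P.isoExt (R := R) (n + 1) Y).isZero_iff, ← HomologicalComplex.exactAt_iff_isZero_homology,
    HomologicalComplex.exactAt_iff' _ n (n + 1) (n + 2) (by simp) (by simp),
    ShortComplex.moduleCat_exact_iff]
  constructor
  · intro hexact
    refine subsingleton_of_forall_eq 0 fun α ↦ ?_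
    obtain ⟨f, hf, rfl⟩ := P.extMk_surjective α (n + 2) rfl
    rw [P.extMk_eq_zero_iff _ _ _ _ n rfl]
    exact hexact f hf
  · intro hsub f hf
    exact (P.extMk_eq_zero_iff f (n + 2) rfl hf n rfl).mp (Subsingleton.elim _ _)

lemma mono_homologyMap_succ_of_forall {K L : CochainComplex (ModuleCat.{u} R) ℕ} (ψ : K ⟶ L)
    (n : ℕ) (h : ∀ x : K.X (n + 1), K.d (n + 1) (n + 2) x = 0 → ∀ y : L.X n,
      ψ.f (n + 1) x = L.d n (n + 1) y → ∃ z : K.X n, x = K.d n (n + 1) z) :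
    Mono (HomologicalComplex.homologyMap ψ (n + 1)) := by
  rw [HomologicalComplex.mono_homologyMap_iff_up_to_refinements ψ n (n + 1) (n + 2)
    (by simp) (by simp)]
  intro A x hx y hy
  choose z hz using fun a : A ↦ h (x a) (LinearMap.congr_fun (congrArg ModuleCat.Hom.hom hx) a)
    (y a) (LinearMap.congr_fun (congrArg ModuleCat.Hom.hom hy) a)
  -- the choice `z` need not be linear, so refine `A` by the free module on its elements
  refine ⟨ModuleCat.of R (A →₀ R), ModuleCat.ofHom (Finsupp.linearCombination R id), ?_,
    ModuleCat.ofHom (Finsupp.linearCombination R z), ?_⟩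
  · rw [ModuleCat.epi_iff_surjective]
    exact Finsupp.linearCombination_id_surjective R A
  · ext a
    simpa using hz a

lemma epi_homologyMap_opFunctor {C : Type*} [Category* C] [Abelian C] {K L : CochainComplex C ℕ}
    (ψ : K ⟶ L) (n : ℕ) [Mono (HomologicalComplex.homologyMap ψ n)] :
    Epi (HomologicalComplex.homologyMap ((HomologicalComplex.opFunctor _ _).map ψ.op) n) := by
  have hnat := (Iso.eq_comp_inv (K.homologyOp n)).mpr
    (HomologicalComplex.homologyOp_hom_naturality ψ n)
  have hcomp : Epi ((L.homologyOp n).hom ≫ (HomologicalComplex.homologyMap ψ n).op) :=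
    inferInstance
  exact hnat ▸ epi_comp' hcomp (@IsIso.epi_of_iso _ _ _ _ _ (Iso.isIso_inv _))

theorem mono_Ext_map_app_of_forall {X X' : ModuleCat.{u} R} (g : X' ⟶ X) (Y : ModuleCat.{u} R)
    (n : ℕ) (hg : ∀ α : Abelian.Ext X Y (n + 1),
      (Abelian.Ext.mk₀ g).comp α (zero_add _) = 0 → α = 0) :
    Mono (((Ext R (ModuleCat.{u} R) (n + 1)).map g.op).app Y) := by
  let F := ((linearYoneda R (ModuleCat.{u} R)).obj Y).rightOp
  let P := projectiveResolution X
  let P' := projectiveResolution X'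
  let φ : ProjectiveResolution.Hom P' P g := ⟨ProjectiveResolution.lift g P' P,
    HomologicalComplex.congr_hom (ProjectiveResolution.lift_commutes g P' P) 0⟩
  let ψ : P.complex.linearYonedaObj R Y ⟶ P'.complex.linearYonedaObj R Y :=
    (HomologicalComplex.unopFunctor _ _).map ((F.mapHomologicalComplex _).map φ.hom).op
  have hcob (x : P.complex.X (n + 1) ⟶ Y) (hx : P.complex.d (n + 2) (n + 1) ≫ x = 0)
      (y : P'.complex.X n ⟶ Y) (hy : φ.hom.f (n + 1) ≫ x = P'.complex.d (n + 1) n ≫ y) :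
      ∃ z, P.complex.d (n + 1) n ≫ z = x := by
    rw [← P.extMk_eq_zero_iff x (n + 2) rfl hx n rfl]
    refine hg _ ?_
    rw [ProjectiveResolution.mk₀_comp_extMk _ _ _ _ φ, P'.extMk_eq_zero_iff _ _ _ _ n rfl]
    exact ⟨y, hy.symm⟩
  have : Mono (HomologicalComplex.homologyMap ψ (n + 1)) := by
    refine mono_homologyMap_succ_of_forall ψ n fun x hx y hy ↦ ?_
    obtain ⟨z, hz⟩ := hcob x hx y hy
    exact ⟨z, hz.symm⟩
  have : Epi ((F.mapHomologicalComplex _ ⋙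
      HomologicalComplex.homologyFunctor _ _ (n + 1)).map φ.hom) :=
    epi_homologyMap_opFunctor ψ (n + 1)
  have : Epi ((F.leftDerived (n + 1)).map g) := epi_leftDerived_map_of_epi F φ (n + 1)
  change Mono ((F.leftDerived (n + 1)).map g).unop
  infer_instance

end ExtComparison

/-! ### Vanishing and non-vanishing of local cohomology -/

section LocalCohomology

open CategoryTheory Limits Opposite RingTheory.Sequence

variable {R : Type u} [CommRing R]

/-- The surjection `R ⧸ J ⟶ R ⧸ I` for `J ≤ I`, in the category of modules: the transition maps of
the system computing local cohomology, and their factors through quotients by other ideals. -/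
def quotientFactor {J I : Ideal R} (h : J ≤ I) :
    ModuleCat.of R (R ⧸ J) ⟶ ModuleCat.of R (R ⧸ I) :=
  ModuleCat.ofHom (Submodule.factor h)

lemma quotientFactor_comp {I J K : Ideal R} (h : J ≤ I) (h' : K ≤ J) :
    quotientFactor h' ≫ quotientFactor h = quotientFactor (h'.trans h) := by
  ext
  rfl

/-- The functoriality of `Ext(-, M)` along `R ⧸ J ⟶ R ⧸ I` for `J ≤ I`. -/
noncomputable def extMapQuotientFactor {J I : Ideal R} (h : J ≤ I) (i : ℕ) (M : ModuleCat.{u} R) :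
    ((Ext R (ModuleCat.{u} R) i).obj (op (ModuleCat.of R (R ⧸ I)))).obj M ⟶
      ((Ext R (ModuleCat.{u} R) i).obj (op (ModuleCat.of R (R ⧸ J)))).obj M :=
  ((Ext R (ModuleCat.{u} R) i).map (quotientFactor h).op).app M

lemma extMapQuotientFactor_comp {I J K : Ideal R} (h : J ≤ I) (h' : K ≤ J) (i : ℕ)
    (M : ModuleCat.{u} R) :
    extMapQuotientFactor h i M ≫ extMapQuotientFactor h' i M =
      extMapQuotientFactor (h'.trans h) i M := by
  rw [extMapQuotientFactor, extMapQuotientFactor, ← NatTrans.comp_app, ← Functor.map_comp,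
    ← op_comp, quotientFactor_comp, extMapQuotientFactor]

/-- The canonical map from `Extⁱ(R ⧸ Iᵗ, M)` to `H_I^i(M)`. -/
noncomputable def extToLocalCohomology (I : Ideal R) (i : ℕ) (M : ModuleCat.{u} R) (t : ℕ) :
    ((Ext R (ModuleCat.{u} R) i).obj (op (ModuleCat.of R (R ⧸ I ^ t)))).obj M ⟶
      (localCohomology I i).obj M :=
  (colimit.ι (localCohomology.diagram (localCohomology.idealPowersDiagram I) i)
    (op (op t))).app M

lemma extMapQuotientFactor_comp_extToLocalCohomology (I : Ideal R) (i : ℕ) (M : ModuleCat.{u} R)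
    {s t : ℕ} (h : t ≤ s) :
    extMapQuotientFactor (Ideal.pow_le_pow_right h) i M ≫ extToLocalCohomology I i M s =
      extToLocalCohomology I i M t :=
  NatTrans.congr_app (colimit.w (localCohomology.diagram (localCohomology.idealPowersDiagram I) i)
    (homOfLE h).op.op) M

/-- `H_I^i(M)` is the colimit of the modules `Extⁱ(R ⧸ Iᵗ, M)`. -/
noncomputable def localCohomologyIsColimit (I : Ideal R) (i : ℕ) (M : ModuleCat.{u} R) :
    IsColimit (((evaluation _ _).obj M).mapCocone
      (colimit.cocone (localCohomology.diagram (localCohomology.idealPowersDiagram I) i))) :=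
  isColimitOfPreserves ((evaluation _ _).obj M) (colimit.isColimit _)

lemma isZero_localCohomology_of_cofinal {I : Ideal R} {n : ℕ} {M : ModuleCat.{u} R}
    (h : ∀ t : ℕ, ∃ (s : ℕ) (J : Ideal R), I ^ s ≤ J ∧ J ≤ I ^ t ∧
      Subsingleton (Abelian.Ext (ModuleCat.of R (R ⧸ J)) M (n + 1))) :
    IsZero ((localCohomology I (n + 1)).obj M) := by
  suffices hzero : ∀ t, extToLocalCohomology I (n + 1) M t = 0 by
    rw [IsZero.iff_id_eq_zero]
    refine (localCohomologyIsColimit I (n + 1) M).hom_ext fun t ↦ ?_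
    exact (congrArg (· ≫ 𝟙 _) (hzero t.unop.unop)).trans (zero_comp.trans comp_zero.symm)
  intro t
  obtain ⟨s, J, hsJ, hJt, hJ⟩ := h t
  have hle : I ^ (s + t) ≤ J := (Ideal.pow_le_pow_right (Nat.le_add_right s t)).trans hsJ
  rw [← extMapQuotientFactor_comp_extToLocalCohomology I _ M (Nat.le_add_left t s),
    ← extMapQuotientFactor_comp hJt hle,
    ((isZero_Ext_succ_iff_subsingleton _ M n).mpr hJ).eq_of_tgt (extMapQuotientFactor hJt _ M) 0,
    zero_comp, zero_comp]

lemma exists_extMapQuotientFactor_eq_zero {I : Ideal R} {i : ℕ} {M : ModuleCat.{u} R}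
    (hzero : IsZero ((localCohomology I i).obj M)) {t : ℕ}
    (x : ((Ext R (ModuleCat.{u} R) i).obj (op (ModuleCat.of R (R ⧸ I ^ t)))).obj M) :
    ∃ (s : ℕ) (h : t ≤ s), extMapQuotientFactor (Ideal.pow_le_pow_right h) i M x = 0 := by
  have : PreservesFilteredColimitsOfSize.{0, 0} (forget (ModuleCat.{u} R)) :=
    preservesFilteredColimitsOfSize_shrink.{0, u, 0, u} _
  have : PreservesColimitsOfShape ℕᵒᵖᵒᵖ (forget (ModuleCat.{u} R)) :=
    PreservesFilteredColimitsOfSize.preserves_filtered_colimits _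
  have hx : extToLocalCohomology I i M t x = extToLocalCohomology I i M t 0 := by
    rw [hzero.eq_of_tgt (extToLocalCohomology I i M t) 0]
    rfl
  obtain ⟨s, f, g, hfg⟩ := Concrete.isColimit_exists_of_rep_eq _
    (localCohomologyIsColimit I i M) (i := op (op t)) (j := op (op t)) x 0 hx
  rw [map_zero] at hfg
  exact ⟨s.unop.unop, f.unop.unop.down.down, hfg⟩

lemma subsingleton_ext_of_isZero_localCohomology {I : Ideal R} {n : ℕ} {M : ModuleCat.{u} R}
    (hzero : IsZero ((localCohomology I (n + 1)).obj M))
    (hinj : ∀ (s : ℕ) (hs : I ^ s ≤ I) (α : Abelian.Ext (ModuleCat.of R (R ⧸ I)) M (n + 1)),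
      (Abelian.Ext.mk₀ (quotientFactor hs)).comp α (zero_add _) = 0 → α = 0) :
    Subsingleton (Abelian.Ext (ModuleCat.of R (R ⧸ I)) M (n + 1)) := by
  rw [← isZero_Ext_succ_iff_subsingleton, IsZero.iff_id_eq_zero]
  ext x
  have hI : I ^ 1 ≤ I := (pow_one I).le
  obtain ⟨s, hs, hx⟩ := exists_extMapQuotientFactor_eq_zero hzero
    (extMapQuotientFactor hI (n + 1) M x)
  rw [← ConcreteCategory.comp_apply, extMapQuotientFactor_comp] at hx
  have hmono : Mono (extMapQuotientFactor ((Ideal.pow_le_pow_right hs).trans hI) (n + 1) M) :=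
    mono_Ext_map_app_of_forall _ _ _ (hinj s _)
  rw [ModuleCat.mono_iff_injective] at hmono
  exact hmono (hx.trans (map_zero _).symm)

end LocalCohomology

/-! ### Grade, height and cohomological dimension -/

section Grade

open CategoryTheory RingTheory.Sequence

variable {R : Type u} [CommRing R] {I : Ideal R}

lemma length_le_grade_of_isRegular {rs : List R} (hreg : IsRegular R rs) (hmem : ∀ r ∈ rs, r ∈ I) :
    (rs.length : ℕ∞) ≤ I.grade :=
  le_iSup_of_le rs (le_iSup_of_le hreg (le_iSup_of_le hmem le_rfl))

lemma length_le_height_of_isWeaklyRegular [IsNoetherianRing R] {rs : List R}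
    (hreg : IsWeaklyRegular R rs) (hmem : ∀ r ∈ rs, r ∈ I) : (rs.length : ℕ∞) ≤ I.height := by
  rw [Ideal.height_eq_inf_minimalPrimes]
  refine le_iInf₂ fun P hP ↦ ?_
  have := hP.1.1
  let L := Localization.AtPrime P
  let rsL := rs.map (algebraMap R L)
  have hregL : IsRegular L rsL :=
    hreg.isRegular_of_isLocalization_of_mem L P fun r hr ↦ hP.1.2 (hmem r hr)
  have : Nontrivial (L ⧸ Ideal.ofList rsL) :=
    Ideal.Quotient.nontrivial_iff.mpr fun h ↦ hregL.2 (by simp [h])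
  have hle : ((rs.length : ℕ∞) : WithBot ℕ∞) ≤ P.height := by
    calc ((rs.length : ℕ∞) : WithBot ℕ∞) ≤ ringKrullDim (L ⧸ Ideal.ofList rsL) + rsL.length := by
          rw [List.length_map]
          exact le_add_of_nonneg_left ringKrullDim_nonneg_of_nontrivial
      _ = P.height := by
          rw [ringKrullDim_add_length_eq_ringKrullDim_of_isRegular _ hregL,
            IsLocalization.AtPrime.ringKrullDim_eq_height P L]
  exact_mod_cast hle

lemma grade_le_height [IsNoetherianRing R] : I.grade ≤ I.height :=
  iSup_le fun _ ↦ iSup_le fun hreg ↦ iSup_le fun hmem ↦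
    length_le_height_of_isWeaklyRegular hreg.1 hmem

lemma exists_isRegular_length_eq_grade [IsNoetherianRing R] (hI : I ≠ ⊤) :
    ∃ rs : List R, IsRegular R rs ∧ (∀ r ∈ rs, r ∈ I) ∧ rs.length = I.grade := by
  have : Nontrivial R := Submodule.nontrivial_iff R |>.mp ⟨I, ⊤, hI⟩
  let lengths : Set ℕ := {n | ∃ rs : List R, IsRegular R rs ∧ (∀ r ∈ rs, r ∈ I) ∧ rs.length = n}
  have hne : lengths.Nonempty := ⟨0, [], (isRegular_iff _ _).mpr (by simp), by simp, rfl⟩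
  have hbdd : BddAbove lengths := by
    obtain ⟨n, hn⟩ := ENat.ne_top_iff_exists.mp (Ideal.height_ne_top hI)
    refine ⟨n, ?_⟩
    rintro _ ⟨rs, hreg, hmem, rfl⟩
    exact_mod_cast (length_le_height_of_isWeaklyRegular hreg.1 hmem).trans_eq hn.symm
  obtain ⟨rs, hreg, hmem, hlen⟩ := Nat.sSup_mem hne hbdd
  refine ⟨rs, hreg, hmem, le_antisymm (length_le_grade_of_isRegular hreg hmem) ?_⟩
  refine iSup_le fun rs' ↦ iSup_le fun hreg' ↦ iSup_le fun hmem' ↦ ?_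
  rw [hlen]
  exact_mod_cast le_csSup hbdd ⟨rs', hreg', hmem', rfl⟩

lemma support_subset_zeroLocus_of_pow_le_annihilator {N : Type*} [AddCommGroup N] [Module R N]
    [Module.Finite R N] {k : ℕ} (h : I ^ k ≤ Module.annihilator R N) :
    Module.support R N ⊆ PrimeSpectrum.zeroLocus I := by
  rw [Module.support_eq_zeroLocus]
  intro p hp x hx
  exact p.2.mem_of_pow_mem k (hp (h (Ideal.pow_mem_pow hx k)))

lemma eq_zero_of_mk₀_quotientFactor_comp_eq_zero [IsNoetherianRing R] {M : ModuleCat.{u} R}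
    [Module.Finite R M] (hlt : I • (⊤ : Submodule R M) < ⊤) {rs : List R} (hmem : ∀ r ∈ rs, r ∈ I)
    (hreg : IsRegular M rs) {n : ℕ} (hn : n < rs.length) {J : Ideal R} (hJ : J ≤ I) {k : ℕ}
    (hk : I ^ k ≤ J) {α : Abelian.Ext (ModuleCat.of R (R ⧸ I)) M (n + 1)}
    (hα : (Abelian.Ext.mk₀ (quotientFactor hJ)).comp α (zero_add _) = 0) : α = 0 := by
  let K := LinearMap.ker (Submodule.factor hJ)
  have hK : I ^ k ≤ Module.annihilator R K := by
    intro r hr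
    rw [Module.mem_annihilator]
    rintro ⟨x, hx⟩
    obtain ⟨x, rfl⟩ := Submodule.mkQ_surjective _ x
    ext
    exact (Submodule.Quotient.mk_eq_zero _).mpr (J.mul_mem_right x (hk hr))
  have hsub : Subsingleton (Abelian.Ext (ModuleCat.of R K) M n) :=
    ModuleCat.subsingleton_ext_of_exists_isRegular I _
      (support_subset_zeroLocus_of_pow_le_annihilator hK) M hlt rs hmem hreg n hn
  obtain ⟨β, rfl⟩ := Abelian.Ext.contravariant_sequence_exact₃
    (LinearMap.shortExact_shortComplexKer (Submodule.factor_surjective hJ)) _ α hα (add_comm 1 n)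
  rw [hsub.elim β 0, Abelian.Ext.comp_zero]

lemma not_subsingleton_ext_of_length_eq_grade [IsNoetherianRing R] (hI : I ≠ ⊤) {rs : List R}
    (hmem : ∀ r ∈ rs, r ∈ I) (hreg : IsRegular R rs) (hlen : rs.length = I.grade) :
    ¬ Subsingleton (Abelian.Ext (ModuleCat.of R (R ⧸ I)) (ModuleCat.of R R) rs.length) := by
  intro hsub
  have hlt : I • (⊤ : Submodule R (ModuleCat.of R R)) < ⊤ := by
    simpa [lt_top_iff_ne_top] using hI
  have hsupp : Module.support R (ModuleCat.of R (R ⧸ I)) = PrimeSpectrum.zeroLocus I := by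
    rw [Module.support_eq_zeroLocus, Ideal.annihilator_quotient]
  obtain ⟨rs', hlen', hmem', hreg'⟩ := ModuleCat.exists_isRegular_of_exists_subsingleton_ext I
    (rs.length + 1) (ModuleCat.of R R) hlt (ModuleCat.of R (R ⧸ I)) hsupp fun i hi ↦ by
      rcases Nat.lt_succ_iff_lt_or_eq.mp hi with hi | rfl
      · exact ModuleCat.subsingleton_ext_of_exists_isRegular I _ hsupp.subset _ hlt rs hmem hreg
          i hi
      · exact hsub
  have hle : rs'.length ≤ rs.length := by
    exact_mod_cast (length_le_grade_of_isRegular hreg' hmem').trans_eq hlen.symm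
  lia

theorem grade_le_cohomologicalDimension [IsNoetherianRing R] (hI : I ≠ ⊤) :
    I.grade ≤ I.cohomologicalDimension := by
  obtain ⟨rs, hreg, hmem, hlen⟩ := exists_isRegular_length_eq_grade hI
  refine le_sInf fun c hc ↦ ?_
  by_contra! hlt
  rw [← hlen] at hlt
  obtain ⟨n, hn⟩ : ∃ n, rs.length = n + 1 :=
    Nat.exists_eq_succ_of_ne_zero fun h ↦ by simp [h] at hlt
  have hne := not_subsingleton_ext_of_length_eq_grade hI hmem hreg hlen
  rw [hn] at hlt hne
  refine hne (subsingleton_ext_of_isZero_localCohomology (hc _ _ hlt) fun s hs α hα ↦ ?_)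
  exact eq_zero_of_mk₀_quotientFactor_comp_eq_zero (by simpa [lt_top_iff_ne_top] using hI) hmem hreg
    (by lia) hs le_rfl hα

theorem cohomologicalDimension_le_of_cofinal {n : ℕ}
    (h : ∀ t : ℕ, ∃ (s : ℕ) (J : Ideal R), I ^ s ≤ J ∧ J ≤ I ^ t ∧
      HasProjectiveDimensionLE (ModuleCat.of R (R ⧸ J)) n) : I.cohomologicalDimension ≤ n := by
  refine sInf_le fun M i hi ↦ ?_
  obtain ⟨i, rfl⟩ : ∃ j, i = j + 1 := Nat.exists_eq_succ_of_ne_zero fun h ↦ by simp [h] at hi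
  refine isZero_localCohomology_of_cofinal fun t ↦ ?_
  obtain ⟨s, J, hs, ht, hpd⟩ := h t
  exact ⟨s, J, hs, ht,
    HasProjectiveDimensionLT.subsingleton _ (n + 1) (i + 1) (by exact_mod_cast hi) _⟩

end Grade

/-! ### Ideals with Frobenius-like ring endomorphisms -/

section FrobeniusLike

open CategoryTheory IsLocalRing RingTheory.Sequence TensorProduct

variable {R : Type u} [CommRing R] {I : Ideal R}

lemma hasProjectiveDimensionLE_quotient_map [IsNoetherianRing R] {n : ℕ}
    (hpd : HasProjectiveDimensionLE (ModuleCat.of R (R ⧸ I)) n) {S : Type u} [CommRing S]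
    (ψ : R →+* S) {xs : List S} (hlen : n ≤ xs.length) (hmem : ∀ x ∈ xs, x ∈ I.map ψ)
    (hreg : IsWeaklyRegular S xs) :
    HasProjectiveDimensionLE (ModuleCat.of S (S ⧸ I.map ψ)) n := by
  let _ : Algebra R S := ψ.toAlgebra
  let e : (S ⧸ I.map ψ) ≃ₗ[S] S ⊗[R] (R ⧸ I) :=
    (Algebra.TensorProduct.quotIdealMapEquivTensorQuot S I).toLinearEquiv
  have := (stablyAnnihilates_quotient I).hasProjectiveDimensionLE_baseChange hpd hlen hmem hreg
  exact hasProjectiveDimensionLT_of_iso e.symm.toModuleIso _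

lemma TorsionEmbeds.length_quotient_map_le {n b : ℕ} (h : TorsionEmbeds I (R ⧸ I) n b)
    {L : Type u} [CommRing L] (ψ : R →+* L) {xs : List L} (hlen : xs.length = n)
    (hmem : ∀ x ∈ xs, x ∈ I.map ψ) (hreg : IsWeaklyRegular L xs)
    (hfin : Module.length L (L ⧸ I.map ψ) ≠ ⊤) :
    Module.length L (L ⧸ I.map ψ) ≤
      b * maxFiniteLength L (L ⧸ (Ideal.ofList xs • ⊤ : Submodule L L)) := by
  let _ : Algebra R L := ψ.toAlgebra
  obtain ⟨f, hf⟩ := h L L xs hlen hmem hreg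
  let e : (L ⧸ I.map ψ) ≃ₗ[L] L ⊗[R] (R ⧸ I) :=
    (Algebra.TensorProduct.quotIdealMapEquivTensorQuot L I).toLinearEquiv
  have he (u : L ⧸ I.map ψ) :
      e u ∈ Submodule.torsionBySet L (L ⊗[R] (R ⧸ I)) {x | x ∈ xs} := by
    rw [Submodule.mem_torsionBySet_iff]
    rintro ⟨x, hx⟩
    obtain ⟨u, rfl⟩ := Ideal.Quotient.mk_surjective u
    have hxu : x • (Ideal.Quotient.mk (I.map ψ)) u = 0 :=
      Ideal.Quotient.eq_zero_iff_mem.mpr (Ideal.mul_mem_right _ _ (hmem x hx))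
    exact (map_smul e x _).symm.trans (by rw [hxu, map_zero])
  have hinj : Function.Injective (f ∘ₗ e.toLinearMap.codRestrict _ he) :=
    hf.comp fun u v huv ↦ e.injective (congrArg Subtype.val huv)
  exact (length_le_maxFiniteLength hinj hfin).trans (maxFiniteLength_fin_fun_le b)

lemma le_of_choose_le {h g C k l : ℕ} (hC : ∀ n, n.choose h ≤ C * (k * n + l) ^ g) : h ≤ g := by
  by_contra! hlt
  set D := h.factorial * C * (k * h + k + l) ^ g
  have hle : (D + 1) ^ h ≤ D * (D + 1) ^ g :=
    calc (D + 1) ^ h = (h + D + 1 - h) ^ h := by congr 1; lia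
      _ ≤ (h + D).descFactorial h := Nat.pow_sub_le_descFactorial _ _
      _ = h.factorial * (h + D).choose h := Nat.descFactorial_eq_factorial_mul_choose _ _
      _ ≤ h.factorial * (C * (k * (h + D) + l) ^ g) := by gcongr; exact hC _
      _ ≤ h.factorial * (C * ((k * h + k + l) * (D + 1)) ^ g) := by
          gcongr
          nlinarith [Nat.zero_le (k * h * D), Nat.zero_le (l * D)]
      _ = D * (D + 1) ^ g := by rw [mul_pow]; ring
  have hpow : (D + 1) * (D + 1) ^ g ≤ (D + 1) ^ h := by
    rw [← pow_succ']
    exact Nat.pow_le_pow_right D.succ_pos hlt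
  exact absurd (Nat.le_of_mul_le_mul_right (hpow.trans hle) (by positivity)) (by lia)

lemma length_quotient_ne_top_of_maximalIdeal_pow_le {L : Type*} [CommRing L] [IsNoetherianRing L]
    [IsLocalRing L] {J : Ideal L} {k : ℕ} (h : maximalIdeal L ^ k ≤ J) :
    Module.length L (L ⧸ J) ≠ ⊤ := by
  rw [Module.length_ne_top_iff, isFiniteLength_iff_isNoetherian_isArtinian]
  refine ⟨inferInstance, ?_⟩
  rcases subsingleton_or_nontrivial (L ⧸ J) with hJ | hJ
  · infer_instance
  have : IsLocalRing (L ⧸ J) :=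
    IsLocalRing.of_surjective' (Ideal.Quotient.mk J) Ideal.Quotient.mk_surjective
  have hnil : maximalIdeal (L ⧸ J) ^ k = 0 := by
    rw [← map_maximalIdeal_of_surjective (Ideal.Quotient.mk J) Ideal.Quotient.mk_surjective,
      ← Ideal.map_pow, Ideal.zero_eq_bot, eq_bot_iff, Ideal.map_le_iff_le_comap]
    exact fun x hx ↦ Ideal.Quotient.eq_zero_iff_mem.mpr (h hx)
  have : IsArtinianRing (L ⧸ J) := isArtinianRing_iff_isNilpotent_maximalIdeal _ |>.mpr ⟨k, hnil⟩
  exact isArtinian_of_surjective_algebraMap (R := L ⧸ J) (S := L) Ideal.Quotient.mk_surjective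

theorem maximalIdeal_height_le_of_length_quotient_pow_le {L : Type*} [CommRing L]
    [IsNoetherianRing L] [IsLocalRing L] {C g : ℕ}
    (hC : ∀ t, Module.length L (L ⧸ maximalIdeal L ^ t) ≤ (C * (t + 1) ^ g : ℕ)) :
    (maximalIdeal L).height ≤ g := by
  obtain ⟨q, -, hq⟩ := Ideal.exists_ltSeries_length_eq_height (maximalIdeal L)
  have hlast : q.last.asIdeal ⊔ maximalIdeal L ≠ ⊤ := by
    rw [sup_eq_right.mpr (le_maximalIdeal q.last.2.ne_top)]
    exact (maximalIdeal.isMaximal L).ne_top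
  obtain ⟨k, hk⟩ := exists_choose_le_length_quotient q hlast
  have hle (n : ℕ) : n.choose q.length ≤ C * (k * n + 2) ^ g := by
    have := (hk n).trans ((Module.length_le_of_surjective _ (Submodule.factor_surjective
      (le_sup_right : _ ≤ q.head.asIdeal ⊔ _))).trans (hC (k * n + 1)))
    exact_mod_cast this
  rw [← hq]
  exact_mod_cast le_of_choose_le hle

lemma TorsionEmbeds.exists_length_quotient_map_le {L : Type u} [CommRing L] [IsNoetherianRing L]
    [IsLocalRing L] (ι : R →+* L) {d : ℕ} (hd : maximalIdeal L ^ d ≤ I.map ι) {rs : List R}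
    (hmem : ∀ r ∈ rs, r ∈ I) (hreg : IsWeaklyRegular L (rs.map ι)) {b : ℕ}
    (hb : TorsionEmbeds I (R ⧸ I) rs.length b) :
    ∃ C : ℕ, ∀ (s : ℕ) (ψ : R →+* L), I.map ι ^ s ≤ I.map ψ →
      Module.length L (L ⧸ I.map ψ) ≤ (C * s ^ rs.length : ℕ) := by
  obtain ⟨c, hc⟩ := ENat.ne_top_iff_exists.mp (maxFiniteLength_ne_top (R := L)
    (M := L ⧸ (Ideal.ofList (rs.map ι) • ⊤ : Submodule L L)))
  refine ⟨b * c, fun s ψ hs ↦ ?_⟩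
  let xs := (rs.map ι).map (· ^ s)
  have hlen : xs.length = rs.length := by simp [xs]
  have hxs (x : L) (hx : x ∈ xs) : x ∈ I.map ψ := by
    obtain ⟨y, hy, rfl⟩ := List.mem_map.mp hx
    obtain ⟨r, hr, rfl⟩ := List.mem_map.mp hy
    exact hs (Ideal.pow_mem_pow (Ideal.mem_map_of_mem _ (hmem r hr)) _)
  have hfin : Module.length L (L ⧸ I.map ψ) ≠ ⊤ :=
    length_quotient_ne_top_of_maximalIdeal_pow_le (k := d * s)
      ((pow_mul (maximalIdeal L) d s).trans_le ((Ideal.pow_right_mono hd s).trans hs))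
  calc Module.length L (L ⧸ I.map ψ)
      ≤ b * maxFiniteLength L (L ⧸ (Ideal.ofList xs • ⊤ : Submodule L L)) :=
        hb.length_quotient_map_le ψ hlen hxs (isWeaklyRegular_map_pow hreg s) hfin
    _ ≤ b * (s ^ (rs.map ι).length * c) := by
        rw [hc]
        gcongr
        exact maxFiniteLength_map_pow_le hreg s
    _ = (b * c * s ^ rs.length : ℕ) := by
        rw [List.length_map]
        push_cast
        ring

theorem TorsionEmbeds.height_le [IsNoetherianRing R] {φ : ℕ → R →+* R} {ν : ℕ}
    (hle : ∀ t, I ^ (ν * t + 1) ≤ I.map (φ t)) (hge : ∀ t, I.map (φ t) ≤ I ^ t) {rs : List R}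
    (hmem : ∀ r ∈ rs, r ∈ I) (hreg : IsWeaklyRegular R rs) {b : ℕ}
    (hb : TorsionEmbeds I (R ⧸ I) rs.length b) {P : Ideal R} (hP : P ∈ I.minimalPrimes) :
    P.height ≤ rs.length := by
  have := hP.1.1
  let L := Localization.AtPrime P
  let ι := algebraMap R L
  have hPL : P.map ι = maximalIdeal L := IsLocalization.AtPrime.map_eq_maximalIdeal P L
  obtain ⟨d, hd⟩ : ∃ d, maximalIdeal L ^ d ≤ I.map ι := by
    refine Ideal.exists_pow_le_of_le_radical_of_fg ?_ (IsNoetherian.noetherian _)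
    rw [IsLocalization.AtPrime.radical_map_of_mem_minimalPrimes L P I hP, hPL]
  have hregL : IsWeaklyRegular L (rs.map ι) :=
    (hreg.isRegular_of_isLocalization_of_mem L P fun r hr ↦ hP.1.2 (hmem r hr)).1
  have hheight : P.height = (maximalIdeal L).height := by
    have := IsLocalization.AtPrime.ringKrullDim_eq_height P L
    exact_mod_cast this.symm.trans maximalIdeal_height_eq_ringKrullDim.symm
  obtain ⟨C, hC⟩ := hb.exists_length_quotient_map_le ι hd hmem hregL
  rw [hheight]
  refine maximalIdeal_height_le_of_length_quotient_pow_le (C := C * (ν + 1) ^ rs.length)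
    fun t ↦ ?_
  have hpow : I.map ι ^ (ν * t + 1) ≤ I.map (ι.comp (φ t)) := by
    rw [← Ideal.map_map, ← Ideal.map_pow]
    exact Ideal.map_mono (hle t)
  have hmap : I.map (ι.comp (φ t)) ≤ maximalIdeal L ^ t := by
    rw [← Ideal.map_map, ← hPL, ← Ideal.map_pow]
    exact Ideal.map_mono ((hge t).trans (Ideal.pow_right_mono hP.1.2 t))
  refine (Module.length_le_of_surjective _ (Submodule.factor_surjective hmap)).trans
    ((hC (ν * t + 1) _ hpow).trans (Nat.cast_le.mpr ?_))
  rw [mul_assoc, ← mul_pow]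
  gcongr
  nlinarith

lemma ne_top_of_isPerfect (h : I.IsPerfect) : I ≠ ⊤ := by
  rintro rfl
  have hzero : Limits.IsZero (ModuleCat.of R (R ⧸ (⊤ : Ideal R))) :=
    ModuleCat.isZero_of_iff_subsingleton.mpr inferInstance
  rw [Ideal.IsPerfect, (projectiveDimension_eq_bot_iff _).mpr hzero] at h
  exact WithBot.bot_ne_coe h

theorem cohomologicalDimension_eq_height_of_isPerfect [IsNoetherianRing R] (h : I.IsPerfect)
    {φ : ℕ → R →+* R} {ν : ℕ} (hle : ∀ t, I ^ (ν * t + 1) ≤ I.map (φ t))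
    (hge : ∀ t, I.map (φ t) ≤ I ^ t) :
    I.cohomologicalDimension = I.height := by
  have hI := ne_top_of_isPerfect h
  obtain ⟨rs, hreg, hmem, hlen⟩ := exists_isRegular_length_eq_grade hI
  have hpd : HasProjectiveDimensionLE (ModuleCat.of R (R ⧸ I)) rs.length := by
    rw [← projectiveDimension_le_iff, h, ← hlen]
    rfl
  have hheight : I.height ≤ I.grade := by
    obtain ⟨P, hP⟩ := Ideal.nonempty_minimalPrimes hI
    obtain ⟨b, hb⟩ := (stablyAnnihilates_quotient I).exists_torsionEmbeds hpd
    exact hlen ▸ (Ideal.height_mono hP.1.2).trans (hb.height_le hle hge hmem hreg.1 hP)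
  have hcd : I.cohomologicalDimension ≤ rs.length := by
    refine cohomologicalDimension_le_of_cofinal fun t ↦ ⟨_, I.map (φ t), hle t, hge t, ?_⟩
    refine hasProjectiveDimensionLE_quotient_map hpd (φ t)
      (xs := rs.map (· ^ (ν * t + 1))) (by simp) (fun x hx ↦ ?_) (isWeaklyRegular_map_pow hreg.1 _)
    obtain ⟨r, hr, rfl⟩ := List.mem_map.mp hx
    exact hle t (Ideal.pow_mem_pow (hmem r hr) _)
  exact le_antisymm (hcd.trans (hlen.trans_le grade_le_height))
    (hheight.trans (grade_le_cohomologicalDimension hI))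

lemma span_pow_le_span_image_pow (F : Finset R) (t : ℕ) :
    Ideal.span (F : Set R) ^ (F.card * t + 1) ≤ Ideal.span ((· ^ t) '' (F : Set R)) := by
  classical
  induction F using Finset.induction_on with
  | empty => simp
  | insert x F hx ih =>
    rw [Finset.card_insert_of_notMem hx, Finset.coe_insert, Ideal.span_insert, Set.image_insert_eq,
      Ideal.span_insert, show (F.card + 1) * t + 1 = t + (F.card * t + 1) by ring]
    refine Ideal.sup_pow_add_le_pow_sup_pow.trans (sup_le_sup ?_ ih)
    rw [Ideal.span_singleton_pow]

lemma span_image_pow_le_span_pow (s : Set R) (t : ℕ) :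
    Ideal.span ((· ^ t) '' s) ≤ Ideal.span s ^ t := by
  rw [Ideal.span_le]
  rintro _ ⟨x, hx, rfl⟩
  exact Ideal.pow_mem_pow (Ideal.subset_span hx) t

end FrobeniusLike

theorem corollary2p3 {A : Type*} [CommRing A] [IsNoetherianRing A]
    {Γ : Type*} [AddCommMonoid Γ] [AddMonoid.FG Γ]
    (S : Set Γ) (𝔞 : Ideal (AddMonoidAlgebra A Γ))
    (h𝔞 : 𝔞 = Ideal.span ((fun γ : Γ => AddMonoidAlgebra.single γ (1 : A)) '' S))
    (hperf : 𝔞.IsPerfect) :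
    𝔞.cohomologicalDimension = 𝔞.height := by
  have : IsNoetherianRing (AddMonoidAlgebra A Γ) := Algebra.FiniteType.isNoetherianRing A _
  obtain ⟨F, hFS, hF⟩ : ∃ F : Finset (AddMonoidAlgebra A Γ),
      ↑F ⊆ (fun γ : Γ => AddMonoidAlgebra.single γ (1 : A)) '' S ∧ 𝔞 = Ideal.span ↑F := by
    rw [h𝔞]
    exact Submodule.fg_span_iff_fg_span_finset_subset _ |>.mp (IsNoetherian.noetherian _)
  let φ (t : ℕ) : AddMonoidAlgebra A Γ →+* AddMonoidAlgebra A Γ :=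
    AddMonoidAlgebra.mapDomainRingHom A (nsmulAddMonoidHom (α := Γ) t)
  have hφ (t : ℕ) : 𝔞.map (φ t) = Ideal.span ((· ^ t) '' (F : Set (AddMonoidAlgebra A Γ))) := by
    rw [hF, Ideal.map_span]
    refine congrArg Ideal.span (Set.image_congr fun x hx ↦ ?_)
    obtain ⟨γ, -, rfl⟩ := hFS hx
    simp [φ, AddMonoidAlgebra.single_pow]
  refine cohomologicalDimension_eq_height_of_isPerfect hperf (φ := φ) (ν := F.card)
    (fun t ↦ ?_) fun t ↦ ?_
  · rw [hφ, hF]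
    exact span_pow_le_span_image_pow F t
  · rw [hφ, hF]
    exact span_image_pow_le_span_pow _ t
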